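/- For $n\ge 1$ write $[n]=\{1,\dots,n\}$, and for a permutation $\pi$ of $[n]$ let $D(\pi)=\{i\in[n-1]:\pi(i)>\pi(i+1)\}$ be its descent set. For $I\subseteq[n-1]$ let $\beta_n(I)$ be the number of permutations $\pi$ of $[n]$ with $D(\pi)=I$, let $\beta^{\mathrm{cyc}}_n(I)$ be the number of those that are $n$-cycles (that is, whose cycle type is $(n)$), and let $$\operatorname{alt}(I)=\#\{i\in[n-2]:|I\cap\{i,i+1\}|=1\}.$$ Let $\varepsilon>0$ be a real number, and for each $n\ge1$ define $$\mathcal I_n=\{I\subseteq[n-1]:\operatorname{alt}(I)>n/2-n^{1-\varepsilon}\}.$$ Then $\mathcal I_n$ is non-empty for every $n\ge4$, and $$\lim_{n\to\infty}\ \max_{I\in\mathcal I_n}\left|\frac{n\,\beta^{\mathrm{cyc}}_n(I)}{\beta_n(I)}-1\right|=0.$$ In other words, uniformly over $I\in\mathcal I_n$, the fraction of $n$-cycles among the permutations of $[n]$ with descent set $I$ is asymptotic to $1/n$. -/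

import Mathlib

open Filter Topology

namespace DescentCycles

/-- The descent set `D(π) = {i : π(i) > π(i+1)} ⊆ {1, …, n-1}` of a permutation `π`.
Permutations of `{1, …, n}` are modelled as permutations of `Fin n = {0, …, n-1}`; the `i`-th
position (for `1 ≤ i ≤ n`) is the element of `Fin n` with value `i - 1`. -/
def descentSet {n : ℕ} (π : Equiv.Perm (Fin n)) : Finset ℕ :=
  {i ∈ Finset.Icc 1 (n - 1) | ∃ a b : Fin n, (a : ℕ) + 1 = i ∧ (b : ℕ) = i ∧ π b < π a}

/-- `π` is an `n`-cycle: its cycle type, as a partition of `n` (fixed points counted as parts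
equal to `1`), is `(n)`. For `n = 1` the identity is an `n`-cycle. -/
def IsFullCycle {n : ℕ} (π : Equiv.Perm (Fin n)) : Prop :=
  π.partition.parts = {n}

instance {n : ℕ} (π : Equiv.Perm (Fin n)) : Decidable (IsFullCycle π) :=
  inferInstanceAs (Decidable (π.partition.parts = {n}))

/-- `β_n(I)`: the number of permutations of size `n` with descent set `I`. -/
def beta (n : ℕ) (I : Finset ℕ) : ℕ :=
  Finset.card {π : Equiv.Perm (Fin n) | descentSet π = I}

/-- `β^cyc_n(I)`: the number of `n`-cycles with descent set `I`. -/
def betaCyc (n : ℕ) (I : Finset ℕ) : ℕ :=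
  Finset.card {π : Equiv.Perm (Fin n) | IsFullCycle π ∧ descentSet π = I}

/-- The alternation set of `I ⊆ {1, …, n-1}`: the `i ∈ {1, …, n-2}` such that exactly one of
`i`, `i + 1` lies in `I`. -/
def altSet (n : ℕ) (I : Finset ℕ) : Finset ℕ :=
  {i ∈ Finset.Icc 1 (n - 2) | (I ∩ {i, i + 1}).card = 1}

/-- The alternation number of `I ⊆ {1, …, n-1}`. -/
def alt (n : ℕ) (I : Finset ℕ) : ℕ := (altSet n I).card

/-- The collection `𝓘_n` of the sets `I ⊆ {1, …, n-1}` with `alt(I) > n/2 - n^(1-ε)`. -/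
def highAlt (ε : ℝ) (n : ℕ) : Set (Finset ℕ) :=
  {I | I ⊆ Finset.Icc 1 (n - 1) ∧ (alt n I : ℝ) > (n : ℝ) / 2 - (n : ℝ) ^ (1 - ε)}

end DescentCycles

/-! Counting by words, in the manner of Gessel and Reutenauer, shows that `n * betaCyc n I` and
`beta n I` differ very little, and `beta n I` is huge when `I` alternates often.

Cut the positions into blocks at `K`. Permutations with descents in `K` correspond to words of a
fixed content (`card_words`); full cycles with descents in `K` and a marked point correspond to the
primitive words among them (`card_primWords`). Every word is a power of a primitive one, so
inclusion-exclusion over `K ⊆ I` writes `beta n I` as a signed sum over `e ∣ n` of `e * betaCyc e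
(divSet (n / e) I)` (`beta_eq_sum_divisors`). The term `e = n` is `n * betaCyc n I`; the others
total at most `n² (n/2)!`.

Building a permutation one position at a time gives `beta n I ≥ n! / (2 ^ alt * (n - alt)!)`
(`factorial_le_beta_mul`). If `alt ≥ n/2 - t`, this is at least `2 ^ (n/2) * (n/2)!` up to a factor
`(n + 1) * (2n) ^ t`. The relative error is thus at most `(2n) ^ (t + 3) / 2 ^ (n/2)`, which tends
to zero for `t = ⌈n ^ (1 - ε)⌉`. -/

namespace DescentCycles

open Finset

/-! ### Descent sets, blocks and words -/

/-- Inclusion-exclusion: recover the number of `s` with `D s = I` from the numbers of `s` with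
`D s ⊆ K` for `K ⊆ I`. -/
theorem sum_powerset_neg_one_card_subset {α : Type*} (S : Finset α) (D : α → Finset ℕ)
    (I : Finset ℕ) :
    ∑ K ∈ I.powerset, (-1 : ℤ) ^ (#I + #K) * (#{s ∈ S | D s ⊆ K} : ℤ) =
      (#{s ∈ S | D s = I} : ℤ) := by
  simp only [card_filter, Nat.cast_sum, mul_sum]
  rw [sum_comm]
  refine sum_congr rfl fun s _ => ?_
  by_cases h : D s ⊆ I
  · have h1 : ∑ K ∈ I.powerset, (-1 : ℤ) ^ (#I + #K) * ((if D s ⊆ K then 1 else 0 : ℕ) : ℤ) =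
        ∑ K ∈ Finset.Icc (D s) I, (-1 : ℤ) ^ (#I + #K) := by
      have : Finset.Icc (D s) I = {K ∈ I.powerset | D s ⊆ K} := by
        ext K; simp [and_comm]
      rw [this, sum_filter]
      refine sum_congr rfl fun K _ => ?_
      split_ifs <;> simp
    rw [h1, Icc_eq_image_powerset h, sum_image]
    · have h2 : ∀ L ∈ (I \ D s).powerset,
          (-1 : ℤ) ^ (#I + #(D s ∪ L)) = (-1) ^ (#I + #(D s)) * (-1) ^ #L := by
        intro L hL
        rw [card_union_of_disjoint, ← pow_add, add_assoc]
        exact disjoint_of_subset_right (mem_powerset.1 hL) disjoint_sdiff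
      rw [sum_congr rfl h2, ← mul_sum, sum_powerset_neg_one_pow_card]
      by_cases h3 : D s = I
      · subst h3; simp [← two_mul]
      · have : I \ D s ≠ ∅ := fun h4 => h3 (subset_antisymm h (sdiff_eq_empty_iff_subset.1 h4))
        simp [h3, this]
    · intro L hL L' hL' hh
      have e1 : ∀ L ∈ (I \ D s).powerset, (D s ∪ L) \ D s = L := fun L hL => by
        rw [union_sdiff_cancel_left]
        exact disjoint_of_subset_right (mem_powerset.1 hL) disjoint_sdiff
      rw [← e1 L hL, ← e1 L' hL']
      exact congrArg (· \ D s) hh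
  · have h3 : D s ≠ I := fun h' => h h'.subset
    simp only [h3, if_false, Nat.cast_zero]
    refine sum_eq_zero fun K hK => ?_
    have : ¬ D s ⊆ K := fun h' => h (h'.trans (mem_powerset.1 hK))
    simp [this]

/-- The index of the block containing `i` when `0, 1, 2, …` is cut in front of each `k ∈ K`. -/
def block (K : Finset ℕ) (i : ℕ) : ℕ := #{k ∈ K | k ≤ i}

theorem block_mono (K : Finset ℕ) : Monotone (block K) := fun _ _ h =>
  card_le_card fun _ hk => by
    simp only [mem_filter] at hk ⊢
    exact ⟨hk.1, hk.2.trans h⟩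

theorem block_lt_block {K : Finset ℕ} {i j k : ℕ} (hk : k ∈ K) (hik : i < k) (hkj : k ≤ j) :
    block K i < block K j := by
  refine card_lt_card ⟨fun l hl => ?_, fun h => ?_⟩
  · simp only [mem_filter] at hl ⊢
    exact ⟨hl.1, by omega⟩
  · have := h (mem_filter.2 ⟨hk, hkj⟩)
    simp only [mem_filter] at this
    omega

theorem block_lt_block_iff_of_mem {K : Finset ℕ} {i k : ℕ} (hk : k ∈ K) :
    block K i < block K k ↔ i < k := by
  refine ⟨fun h => ?_, fun h => block_lt_block hk h le_rfl⟩
  by_contra h'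
  exact absurd (block_mono K (not_lt.1 h')) (not_le.2 h)

theorem mem_descentSet {n : ℕ} {π : Equiv.Perm (Fin n)} {i : ℕ} :
    i ∈ descentSet π ↔ ∃ h : i + 1 < n + 1, ∃ h' : 1 ≤ i,
      π ⟨i, by omega⟩ < π ⟨i - 1, by omega⟩ := by
  simp only [descentSet, mem_filter, mem_Icc]
  constructor
  · rintro ⟨⟨h1, h2⟩, a, b, rfl, hb, h⟩
    refine ⟨by omega, h1, ?_⟩
    convert h using 2
    · exact Fin.ext hb.symm
    · exact Fin.ext (by simp)
  · rintro ⟨h, h', hlt⟩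
    exact ⟨by omega, ⟨i - 1, by omega⟩, ⟨i, by omega⟩, by simp; omega, rfl, hlt⟩

theorem descentSet_subset_iff {n : ℕ} {π : Equiv.Perm (Fin n)} {K : Finset ℕ} :
    descentSet π ⊆ K ↔ ∀ i j : Fin n, i < j → block K i = block K j → π i < π j := by
  constructor
  · intro h
    have key : ∀ (d i : ℕ) (hd : i + (d + 1) < n),
        block K i = block K (i + (d + 1)) → π ⟨i, by omega⟩ < π ⟨i + (d + 1), hd⟩ := by
      intro d
      induction d with
      | zero =>
        intro i hd hb
        by_contra hlt
        have hne : π ⟨i, by omega⟩ ≠ π ⟨i + (0 + 1), hd⟩ := by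
          simp
        have : i + 1 ∈ descentSet π :=
          mem_descentSet.2 ⟨by omega, by omega, lt_of_le_of_ne (not_lt.1 hlt) hne.symm⟩
        exact absurd hb (block_lt_block (h this) (by omega) (by omega)).ne
      | succ d ih =>
        intro i hd hb
        have h1 : block K i ≤ block K (i + (d + 1)) := block_mono K (by omega)
        have h2 : block K (i + (d + 1)) ≤ block K (i + (d + 1 + 1)) := block_mono K (by omega)
        refine (ih i (by omega) (by omega)).trans ?_
        by_contra hlt
        have hne : π ⟨i + (d + 1), by omega⟩ ≠ π ⟨i + (d + 1 + 1), hd⟩ := by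
          simp
        have : i + (d + 1 + 1) ∈ descentSet π :=
          mem_descentSet.2 ⟨by omega, by omega, lt_of_le_of_ne (not_lt.1 hlt) hne.symm⟩
        have := (block_lt_block (h this) (i := i + (d + 1)) (by omega) le_rfl)
        omega
    intro i j hij hb
    obtain ⟨d, hd⟩ : ∃ d, (j : ℕ) = i + (d + 1) := ⟨j - i - 1, by omega⟩
    have := key d i (by omega) (by rw [← hd]; exact hb)
    convert this using 2
    exact Fin.ext hd
  · intro h k hk
    obtain ⟨h1, h2, hlt⟩ := mem_descentSet.1 hk
    by_contra hkK
    refine absurd (h ⟨k - 1, by omega⟩ ⟨k, by omega⟩ (by simp [Fin.lt_def]; omega) ?_) hlt.not_gt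
    refine congrArg card (filter_congr fun l hl => ?_)
    have : l ≠ k := fun e => hkK (e ▸ hl)
    simp only
    omega

/-- Words of length `n` with the content of the sorted word `block K 0, …, block K (n - 1)`. -/
def words (n : ℕ) (K : Finset ℕ) : Finset (Fin n → ℕ) :=
  univ.image fun (σ : Equiv.Perm (Fin n)) t => block K (σ t)

theorem mem_words {n : ℕ} {K : Finset ℕ} {w : Fin n → ℕ} :
    w ∈ words n K ↔ ∃ σ : Equiv.Perm (Fin n), ∀ t, w t = block K (σ t) := by
  simp [words, funext_iff, eq_comm]

theorem comp_eq_block {n : ℕ} {K : Finset ℕ} {w : Fin n → ℕ} (hw : w ∈ words n K)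
    {ρ : Equiv.Perm (Fin n)} (hρ : Monotone (w ∘ ρ)) (t : Fin n) : w (ρ t) = block K t := by
  obtain ⟨σ, hσ⟩ := mem_words.1 hw
  have h1 : w ∘ σ.symm = fun t : Fin n => block K t := by
    funext t; simp [hσ]
  have h2 : Monotone (w ∘ σ.symm) := by
    rw [h1]; exact fun a b h => block_mono K h
  have := Tuple.unique_monotone hρ h2
  rw [h1] at this
  exact congrFun this t

/-- The word records, for each value, the block of its position. The inverse is the stable sort
`Tuple.sort`: breaking ties by position is the same as being increasing on each block. -/
theorem card_words (n : ℕ) (K : Finset ℕ) :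
    #{π : Equiv.Perm (Fin n) | descentSet π ⊆ K} = #(words n K) := by
  refine card_bij (fun π _ t => block K (π.symm t)) (fun π _ => ?_) ?_ ?_
  · exact mem_words.2 ⟨π.symm, fun _ => rfl⟩
  · have key : ∀ π : Equiv.Perm (Fin n), descentSet π ⊆ K →
        π = Tuple.sort fun t => block K (π.symm t) := by
      intro π hπ
      rw [Tuple.eq_sort_iff]
      refine ⟨fun a b h => ?_, fun i j hij hb => ?_⟩
      · simpa using block_mono K h
      · exact descentSet_subset_iff.1 hπ i j hij (by simpa using hb)
    intro π hπ π' hπ' h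
    rw [key π (by simpa using hπ), key π' (by simpa using hπ')]
    exact congrArg Tuple.sort h
  · intro w hw
    have hs := Tuple.eq_sort_iff.1 (rfl : Tuple.sort w = Tuple.sort w)
    have hb := comp_eq_block hw hs.1
    refine ⟨Tuple.sort w, ?_, ?_⟩
    · simp only [mem_filter, mem_univ, true_and]
      exact descentSet_subset_iff.2 fun i j hij h => hs.2 i j hij (by rw [hb, hb, h])
    · funext t
      rw [← hb]; simp

/-- `IsCycleOn` is used rather than `IsCycle` because it also holds for the identity when `n = 1`.
-/
theorem isFullCycle_iff {n : ℕ} (hn : 1 ≤ n) {π : Equiv.Perm (Fin n)} :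
    IsFullCycle π ↔ π.IsCycleOn (Set.univ : Set (Fin n)) := by
  rcases eq_or_lt_of_le hn with rfl | hn
  · refine iff_of_true ?_ (Equiv.Perm.isCycleOn_of_subsingleton _ _)
    have : π = 1 := Subsingleton.elim _ _
    subst this
    simp [IsFullCycle, Equiv.Perm.parts_partition]
  have hnt : Nontrivial (Fin n) := Fin.nontrivial_iff_two_le.2 hn
  constructor
  · intro h
    have h1 := congrArg Multiset.card h
    have h2 := congrArg Multiset.sum h
    rw [Equiv.Perm.parts_partition] at h1 h2
    simp only [Multiset.card_add, Multiset.card_replicate, Multiset.card_singleton,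
      Multiset.sum_add, Multiset.sum_replicate, Multiset.sum_singleton, Equiv.Perm.sum_cycleType,
      Fintype.card_fin] at h1 h2
    have hs : #π.support ≤ n := by simpa using card_le_univ π.support
    have hc : #π.support ≠ 0 := fun h0 => by
      have h3 := Equiv.Perm.support_eq_empty_iff.1 (card_eq_zero.1 h0)
      subst h3
      simp at h1
      omega
    have hc' : Multiset.card π.cycleType ≠ 0 := fun h0 => by
      have h3 := Equiv.Perm.cycleType_eq_zero.1 (Multiset.card_eq_zero.1 h0)
      subst h3
      simp at hc
    have hcyc : π.IsCycle := Equiv.Perm.card_cycleType_eq_one.1 (by omega)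
    have hsupp : π.support = univ := by
      rw [← card_eq_iff_eq_univ, Fintype.card_fin]; omega
    have := hcyc.isCycleOn
    convert this using 1
    ext x
    have : x ∈ π.support := by rw [hsupp]; exact mem_univ x
    simpa using this
  · intro h
    have hcyc : π.IsCycle := Equiv.Perm.isCycle_iff_exists_isCycleOn.2
      ⟨Set.univ, Set.nontrivial_univ, h, fun x _ => Set.mem_univ x⟩
    have hsupp : π.support = univ := by
      ext x
      simpa using h.apply_ne Set.nontrivial_univ (Set.mem_univ x)
    simp [IsFullCycle, Equiv.Perm.parts_partition, hcyc.cycleType, hsupp]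

/-! ### Full cycles and primitive words -/

/-- The shift of a sequence. -/
def shift (f : ℕ → ℕ) : ℕ → ℕ := fun t => f (t + 1)

theorem shift_iterate (s : ℕ) (f : ℕ → ℕ) : shift^[s] f = fun u => f (u + s) := by
  induction s generalizing f with
  | zero => rfl
  | succ s ih =>
    rw [Function.iterate_succ_apply, ih]
    funext u
    simp only [shift]
    congr 1

/-- The periodic sequence obtained by repeating a word. -/
def cyc {n : ℕ} [NeZero n] (w : Fin n → ℕ) : ℕ → ℕ := fun t => w (Fin.ofNat n t)

theorem cyc_coe {n : ℕ} [NeZero n] (w : Fin n → ℕ) (t : Fin n) : cyc w t = w t := by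
  simp [cyc]

theorem isPeriodicPt_shift_iff {f : ℕ → ℕ} {n : ℕ} :
    Function.IsPeriodicPt shift n f ↔ Function.Periodic f n := by
  simp [Function.IsPeriodicPt, Function.IsFixedPt, shift_iterate, funext_iff, Function.Periodic]

theorem isPeriodicPt_cyc {n : ℕ} [NeZero n] (w : Fin n → ℕ) :
    Function.IsPeriodicPt shift n (cyc w) := by
  rw [isPeriodicPt_shift_iff]
  intro t
  simp only [cyc]
  congr 1
  apply Fin.ext
  simp [Fin.ofNat]

/-- The words in `words n K` that are not proper powers. -/
noncomputable def primWords (n : ℕ) [NeZero n] (K : Finset ℕ) : Finset (Fin n → ℕ) :=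
  {w ∈ words n K | Function.minimalPeriod shift (cyc w) = n}

/-- Since `π` is increasing on each block, the two orbits keep their order as long as their letters
agree, so the first differing letters compare the right way. -/
theorem toLex_block_orbit_lt {n : ℕ} {K : Finset ℕ} {π : Equiv.Perm (Fin n)}
    (hπ : π.IsCycleOn (Set.univ : Set (Fin n))) (hK : descentSet π ⊆ K) {i j : Fin n}
    (hij : i < j) :
    toLex (fun u => block K ((π ^ u) i)) < toLex (fun u => block K ((π ^ u) j)) := by
  have step : ∀ u, (∀ v < u, block K ((π ^ v) i) = block K ((π ^ v) j)) →
      (π ^ u) i < (π ^ u) j := by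
    intro u
    induction u with
    | zero => intro _; simpa using hij
    | succ u ih =>
      intro h
      rw [pow_succ', Equiv.Perm.mul_apply, Equiv.Perm.mul_apply]
      exact descentSet_subset_iff.1 hK _ _ (ih fun v hv => h v (by omega)) (h u (by omega))
  have hex : ∃ u, block K ((π ^ u) i) ≠ block K ((π ^ u) j) := by
    by_contra! hall
    have hall' : ∀ u, (π ^ u) i < (π ^ u) j := fun u => step u fun v _ => hall v
    obtain ⟨m, hm⟩ := hπ.exists_pow_eq' Set.finite_univ (Set.mem_univ i) (Set.mem_univ j)
    -- If the letters always agreed, repeatedly applying `π ^ m`, which takes `i` to `j`, would give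
    -- an infinite increasing sequence in `Fin n`.
    have hmono : StrictMono fun q : ℕ => (π ^ (m * q)) i := by
      refine strictMono_nat_of_lt_succ fun q => ?_
      have := hall' (m * q)
      rwa [← hm, ← Equiv.Perm.mul_apply, ← pow_add, ← Nat.mul_succ] at this
    exact not_injective_infinite_finite _ hmono.injective
  refine ⟨Nat.find hex, fun v hv => not_not.1 (Nat.find_min hex hv), ?_⟩
  refine lt_of_le_of_ne (block_mono K ?_) (Nat.find_spec hex)
  exact (step _ fun v hv => not_not.1 (Nat.find_min hex hv)).le

theorem shift_iterate_cyc_orbit {n : ℕ} [NeZero n] (K : Finset ℕ) {π : Equiv.Perm (Fin n)}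
    (hπ : π.IsCycleOn (Set.univ : Set (Fin n))) (x : Fin n) (s : ℕ) :
    shift^[s] (cyc fun t : Fin n => block K ((π ^ (t : ℕ)) x)) =
      fun u => block K ((π ^ u) ((π ^ s) x)) := by
  rw [shift_iterate]
  funext u
  simp only [cyc]
  congr 2
  rw [← Equiv.Perm.mul_apply, ← pow_add]
  have h' : π.IsCycleOn ((univ : Finset (Fin n)) : Set (Fin n)) := by simpa using hπ
  rw [h'.pow_apply_eq_pow_apply (mem_univ x)]
  simp [Fin.ofNat, Nat.ModEq]

theorem bijective_orbit {n : ℕ} {π : Equiv.Perm (Fin n)}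
    (hπ : π.IsCycleOn (Set.univ : Set (Fin n))) (x : Fin n) :
    Function.Bijective fun t : Fin n => (π ^ (t : ℕ)) x := by
  rw [← Finite.surjective_iff_bijective]
  intro y
  have h' : π.IsCycleOn ((univ : Finset (Fin n)) : Set (Fin n)) := by simpa using hπ
  obtain ⟨t, ht, rfl⟩ := h'.exists_pow_eq (mem_univ x) (mem_univ y)
  exact ⟨⟨t, by simpa using ht⟩, rfl⟩

theorem orbit_lt_iff {n : ℕ} [NeZero n] {K : Finset ℕ} {π : Equiv.Perm (Fin n)}
    (hπ : π.IsCycleOn (Set.univ : Set (Fin n))) (hK : descentSet π ⊆ K) (x : Fin n) (s t : ℕ) :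
    (π ^ s) x < (π ^ t) x ↔
      toLex (shift^[s] (cyc fun t : Fin n => block K ((π ^ (t : ℕ)) x))) <
        toLex (shift^[t] (cyc fun t : Fin n => block K ((π ^ (t : ℕ)) x))) := by
  rw [shift_iterate_cyc_orbit K hπ, shift_iterate_cyc_orbit K hπ]
  refine ⟨toLex_block_orbit_lt hπ hK, fun h => ?_⟩
  rcases lt_trichotomy ((π ^ s) x) ((π ^ t) x) with h' | h' | h'
  · exact h'
  · rw [h'] at h; exact absurd h (lt_irrefl _)
  · exact absurd h (toLex_block_orbit_lt hπ hK h').asymm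

theorem exists_perm_lt_iff {n : ℕ} {α : Type*} [LinearOrder α] {κ : Fin n → α}
    (hκ : Function.Injective κ) :
    ∃ ρ : Equiv.Perm (Fin n), ∀ s t, ρ s < ρ t ↔ κ s < κ t := by
  have hm : StrictMono (κ ∘ Tuple.sort κ) :=
    (Tuple.monotone_sort κ).strictMono_of_injective (hκ.comp (Tuple.sort κ).injective)
  refine ⟨(Tuple.sort κ).symm, fun s t => ?_⟩
  rw [← hm.lt_iff_lt]
  simp

theorem perm_eq_of_lt_iff {n : ℕ} {σ τ : Equiv.Perm (Fin n)}
    (h : ∀ s t, σ s < σ t ↔ τ s < τ t) : σ = τ := by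
  have hm : StrictMono (τ * σ⁻¹ : Equiv.Perm (Fin n)) := by
    intro a b hab
    simpa [← h] using hab
  have h1 : (hm.orderIsoOfSurjective _ (τ * σ⁻¹ : Equiv.Perm (Fin n)).surjective) =
      OrderIso.refl (Fin n) := Subsingleton.elim _ _
  ext s
  have := DFunLike.congr_fun h1 (σ s)
  simp at this
  rw [this]

theorem toLex_shift_lt {f g : ℕ → ℕ} (h : toLex f < toLex g) (h0 : f 0 = g 0) :
    toLex (shift f) < toLex (shift g) := by
  obtain ⟨i, hi, hlt⟩ := h
  cases i with
  | zero => exact absurd h0 hlt.ne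
  | succ i => exact ⟨i, fun j hj => hi (j + 1) (by omega), hlt⟩

/-- A pair `(π, x)` is sent to the itinerary of `x` through the blocks. Points of the cycle are
ordered as their itineraries are lexicographically, so `π` can be rebuilt by ranking the rotations
of the word. -/
theorem card_primWords (n : ℕ) [NeZero n] (K : Finset ℕ) :
    #{p : Equiv.Perm (Fin n) × Fin n | IsFullCycle p.1 ∧ descentSet p.1 ⊆ K} =
      #(primWords n K) := by
  have hn : 1 ≤ n := NeZero.one_le
  refine card_bij (fun p _ t => block K ((p.1 ^ (t : ℕ)) p.2)) ?_ ?_ ?_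
  · rintro ⟨π, x⟩ hp
    obtain ⟨hπ, hK⟩ := (mem_filter.1 hp).2
    simp only at hπ hK
    rw [isFullCycle_iff hn] at hπ
    refine mem_filter.2 ⟨mem_words.2 ⟨Equiv.ofBijective _ (bijective_orbit hπ x),
      fun t => rfl⟩, ?_⟩
    set w := fun t : Fin n => block K ((π ^ (t : ℕ)) x)
    have hdvd := (isPeriodicPt_cyc w).minimalPeriod_dvd
    set p := Function.minimalPeriod shift (cyc w) with hp
    by_contra hne
    have hlt : p < n := lt_of_le_of_ne (Nat.le_of_dvd hn hdvd) hne
    have hpos : 0 < p := Nat.pos_of_dvd_of_pos hdvd hn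
    have hper : shift^[p] (cyc w) = shift^[0] (cyc w) :=
      Function.isPeriodicPt_minimalPeriod shift (cyc w)
    -- A shorter period would give two distinct points of the cycle the same itinerary.
    have h0 : (π ^ p) x ≠ (π ^ 0) x := fun h => by
      have := (bijective_orbit hπ x).1 (a₁ := ⟨p, hlt⟩) (a₂ := ⟨0, hn⟩) h
      simp at this
      omega
    rcases lt_or_gt_of_ne h0 with h | h
    · have := (orbit_lt_iff hπ hK x p 0).1 h
      rw [hper] at this
      exact lt_irrefl _ this
    · have := (orbit_lt_iff hπ hK x 0 p).1 h
      rw [hper] at this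
      exact lt_irrefl _ this
  · rintro ⟨π, x⟩ hp ⟨π', x'⟩ hp' heq
    obtain ⟨hπ, hK⟩ := (mem_filter.1 hp).2
    obtain ⟨hπ', hK'⟩ := (mem_filter.1 hp').2
    simp only at hπ hK hπ' hK' heq
    rw [isFullCycle_iff hn] at hπ hπ'
    -- Both orbit maps order the times `0, …, n - 1` as the same rotations are ordered, so they
    -- coincide.
    have key : Equiv.ofBijective _ (bijective_orbit hπ x) =
        Equiv.ofBijective _ (bijective_orbit hπ' x') := by
      refine perm_eq_of_lt_iff fun s t => ?_
      simp only [Equiv.ofBijective_apply]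
      rw [orbit_lt_iff hπ hK, orbit_lt_iff hπ' hK', heq]
    have h1 : ∀ t : ℕ, (π ^ t) x = (π' ^ t) x' := by
      intro t
      have e1 : ∀ {π : Equiv.Perm (Fin n)} (_ : π.IsCycleOn (Set.univ : Set (Fin n)))
          (x : Fin n), (π ^ t) x = (π ^ (t % n)) x := by
        intro π hπ x
        have h' : π.IsCycleOn ((univ : Finset (Fin n)) : Set (Fin n)) := by simpa using hπ
        rw [h'.pow_apply_eq_pow_apply (mem_univ x)]
        simp [Nat.ModEq]
      rw [e1 hπ, e1 hπ']
      exact DFunLike.congr_fun key ⟨t % n, Nat.mod_lt _ hn⟩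
    have hx : x = x' := h1 0
    subst hx
    refine Prod.ext ?_ rfl
    simp only
    ext y
    obtain ⟨t, rfl⟩ := (bijective_orbit hπ x).2 y
    simp only
    rw [← Equiv.Perm.mul_apply, ← pow_succ', h1 t, ← Equiv.Perm.mul_apply, ← pow_succ',
      h1 (t + 1)]
  · intro w hw
    obtain ⟨hw, hper⟩ := mem_filter.1 hw
    -- Primitivity makes the `n` rotations distinct; `ρ` below is their ranking.
    have hinj : Function.Injective fun s : Fin n => toLex (shift^[(s : ℕ)] (cyc w)) := by
      intro s t hst
      have := Function.iterate_injOn_Iio_minimalPeriod (f := shift) (x := cyc w)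
        (by rw [hper]; exact s.2 : (s : ℕ) ∈ Set.Iio _) (by rw [hper]; exact t.2)
        (toLex.injective hst)
      exact Fin.ext this
    obtain ⟨ρ, hρ⟩ := exists_perm_lt_iff hinj
    have h0 : ∀ s : Fin n, (shift^[(s : ℕ)] (cyc w)) 0 = w s := fun s => by
      rw [shift_iterate]; simp [cyc_coe]
    have hmono : Monotone (w ∘ ρ.symm) := by
      intro a b hab
      have h1 : toLex (shift^[(ρ.symm a : ℕ)] (cyc w)) ≤
          toLex (shift^[(ρ.symm b : ℕ)] (cyc w)) := by
        refine not_lt.1 fun h => ?_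
        have := (hρ _ _).2 h
        simp only [Equiv.apply_symm_apply] at this
        omega
      have := Pi.apply_le_of_toLex (i := 0) h1 (by simp)
      rwa [h0, h0] at this
    have hb : ∀ t, w t = block K (ρ t) := fun t => by
      have := comp_eq_block hw hmono (ρ t)
      simpa using this
    have hsucc : ∀ s : Fin n, shift^[((finRotate n s : Fin n) : ℕ)] (cyc w) =
        shift (shift^[(s : ℕ)] (cyc w)) := by
      intro s
      rw [← Function.iterate_succ_apply' shift, ← Function.iterate_mod_minimalPeriod_eq (n := s + 1),
        hper, finRotate_apply]
      congr 1
      simp [Fin.val_add]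
    -- The cycle takes the rank of each rotation to the rank of the next one.
    set π : Equiv.Perm (Fin n) := ρ * finRotate n * ρ⁻¹ with hπ
    have hπρ : ∀ s, π (ρ s) = ρ (finRotate n s) := fun s => by simp [hπ]
    have hpow : ∀ t : ℕ, (π ^ t) (ρ 0) = ρ (Fin.ofNat n t) := by
      intro t
      induction t with
      | zero => simp
      | succ t ih =>
        rw [pow_succ', Equiv.Perm.mul_apply, ih, hπρ, finRotate_apply]
        congr 1
        apply Fin.ext
        simp [Fin.ofNat, Fin.val_add]
    have hcycle : π.IsCycleOn (Set.univ : Set (Fin n)) := by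
      have h1 : ∀ y, π.SameCycle (ρ 0) y := fun y => by
        refine ⟨((ρ.symm y : Fin n) : ℕ), ?_⟩
        rw [zpow_natCast, hpow]
        simp
      exact ⟨Set.bijOn_univ.2 π.bijective, fun x _ y _ => (h1 x).symm.trans (h1 y)⟩
    refine ⟨(π, ρ 0), mem_filter.2 ⟨mem_univ _, (isFullCycle_iff hn).2 hcycle, ?_⟩, ?_⟩
    · refine descentSet_subset_iff.2 fun i j hij hbij => ?_
      obtain ⟨s, rfl⟩ := ρ.surjective i
      obtain ⟨t, rfl⟩ := ρ.surjective j
      rw [hπρ, hπρ, hρ, hsucc, hsucc]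
      -- Ranks in one block belong to rotations with the same first letter; deleting it preserves
      -- their order.
      refine toLex_shift_lt ((hρ s t).1 hij) ?_
      rw [h0, h0, hb, hb, hbij]
    · funext t
      simp only [hpow, hb]
      simp

/-! ### Minimal periods and the sum over divisors -/

theorem card_filter_fin_eq_count (n : ℕ) (p : ℕ → Prop) [DecidablePred p] :
    #{t : Fin n | p t} = Nat.count p n := by
  rw [Nat.count_eq_card_filter_range]
  refine card_bij (fun t _ => (t : ℕ)) (fun t ht => ?_) (fun a _ b _ h => Fin.ext h) ?_
  · simpa using ht
  · intro t ht
    simp only [mem_filter, mem_range] at ht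
    exact ⟨⟨t, ht.1⟩, by simpa using ht.2, rfl⟩

theorem count_cyc_of_mem_words {n : ℕ} [NeZero n] {K : Finset ℕ} {w : Fin n → ℕ}
    (hw : w ∈ words n K) (p : ℕ → Prop) [DecidablePred p] :
    Nat.count (fun t => p (cyc w t)) n = Nat.count (fun t => p (block K t)) n := by
  obtain ⟨σ, hσ⟩ := mem_words.1 hw
  rw [← card_filter_fin_eq_count, ← card_filter_fin_eq_count]
  refine card_bij (fun t _ => σ t) (fun t ht => ?_) (fun a _ b _ h => σ.injective h) ?_
  · simpa [cyc_coe, hσ] using ht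
  · intro t ht
    exact ⟨σ.symm t, by simpa [cyc_coe, hσ] using ht, by simp⟩

theorem mem_words_iff_count {n : ℕ} [NeZero n] {K : Finset ℕ} {w : Fin n → ℕ} :
    w ∈ words n K ↔ ∀ c,
      Nat.count (fun t => cyc w t = c) n = Nat.count (fun t => block K t = c) n := by
  refine ⟨fun hw c => count_cyc_of_mem_words hw (· = c), fun h => ?_⟩
  have h1 : ∀ c, Nonempty ({t : Fin n // w t = c} ≃ {t : Fin n // block K t = c}) := fun c => by
    rw [← Fintype.card_eq, Fintype.card_subtype, Fintype.card_subtype]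
    have := h c
    rw [← card_filter_fin_eq_count, ← card_filter_fin_eq_count] at this
    simpa [cyc_coe] using this
  exact mem_words.2 ⟨Equiv.ofFiberEquiv (g := fun t : Fin n => block K t)
    fun c => Classical.choice (h1 c),
    fun t => (Equiv.ofFiberEquiv_map (g := fun t : Fin n => block K t) _ t).symm⟩

theorem count_of_periodic {p : ℕ → Prop} [DecidablePred p] {e d n : ℕ}
    (hp : ∀ t, p (t + e) ↔ p t) (hn : e * d = n) : Nat.count p n = d * Nat.count p e := by
  subst hn
  induction d with
  | zero => simp
  | succ d ih =>
    rw [mul_add, mul_one, add_comm, Nat.count_add]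
    have : (fun k => p (e + k)) = p := funext fun k => propext (by rw [add_comm]; exact hp k)
    simp only [this, ih]
    ring

theorem count_comp_div (p : ℕ → Prop) [DecidablePred p] {d : ℕ} (hd : 0 < d) (e : ℕ) :
    Nat.count (fun t => p (t / d)) (e * d) = d * Nat.count p e := by
  induction e with
  | zero => simp
  | succ e ih =>
    rw [add_mul, one_mul, Nat.count_add, ih, Nat.count_succ, mul_add]
    congr 1
    have h1 : ∀ k < d, (e * d + k) / d = e := fun k hk => by
      rw [mul_comm, Nat.mul_add_div hd, Nat.div_eq_of_lt hk, add_zero]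
    split_ifs with h
    · rw [mul_one, Nat.count_iff_forall]
      intro k hk
      rwa [h1 k hk]
    · rw [mul_zero, Nat.count_iff_forall_not]
      intro k hk
      rwa [h1 k hk]

theorem block_image_mul {d : ℕ} (hd : 0 < d) (K : Finset ℕ) (i : ℕ) :
    block (K.image (d * ·)) i = block K (i / d) := by
  have hinj : Function.Injective (d * · : ℕ → ℕ) := mul_right_injective₀ hd.ne'
  rw [block, filter_image, card_image_of_injective _ hinj, block]
  congr 1
  refine filter_congr fun k _ => ?_
  rw [Nat.le_div_iff_mul_le hd, mul_comm]

theorem cyc_eq_of_isPeriodicPt {e : ℕ} [NeZero e] {f : ℕ → ℕ}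
    (hf : Function.IsPeriodicPt shift e f) : cyc (fun t : Fin e => f t) = f := by
  rw [isPeriodicPt_shift_iff] at hf
  funext t
  simp only [cyc, Fin.ofNat]
  exact hf.map_mod_nat t

/-- As `k` is a cut, exactly `k` letters of `w` are smaller than `block K k`; with `d` repetitions
of a period this number is a multiple of `d`. -/
theorem dvd_of_mem_words {n e d : ℕ} [NeZero n] (hn : e * d = n) {K : Finset ℕ}
    (hK : K ⊆ Finset.Icc 1 (n - 1)) {w : Fin n → ℕ} (hw : w ∈ words n K)
    (hper : Function.IsPeriodicPt shift e (cyc w)) {k : ℕ} (hk : k ∈ K) : d ∣ k := by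
  have h1 := count_cyc_of_mem_words hw (· < block K k)
  simp only [block_lt_block_iff_of_mem hk] at h1
  have h2 : Nat.count (fun t => t < k) n = k := by
    rw [Nat.count_eq_card_filter_range]
    have := mem_Icc.1 (hK hk)
    have h3 : {t ∈ range n | t < k} = range k := by
      ext t; simp; omega
    rw [h3, card_range]
  rw [isPeriodicPt_shift_iff] at hper
  rw [h2, count_of_periodic (fun t => by rw [hper t]) hn] at h1
  exact ⟨_, h1.symm⟩

/-- The bijection takes a word to its primitive root of length `e`. Scaling the cuts by `d`
multiplies every letter's multiplicity by `d`. -/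
theorem card_words_minimalPeriod {n e d : ℕ} [NeZero n] [NeZero e] (hn : e * d = n)
    (K : Finset ℕ) :
    #{w ∈ words n (K.image (d * ·)) | Function.minimalPeriod shift (cyc w) = e} =
      #(primWords e K) := by
  have hd : 0 < d := Nat.pos_of_ne_zero fun h => NeZero.ne n (by rw [← hn, h, mul_zero])
  have hcount : ∀ c, Nat.count (fun t => block (K.image (d * ·)) t = c) n =
      d * Nat.count (fun t => block K t = c) e := fun c => by
    simp only [block_image_mul hd]
    rw [← hn, count_comp_div (fun t => block K t = c) hd]
  have hmem : ∀ (w : Fin n → ℕ) (v : Fin e → ℕ), cyc w = cyc v →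
      (w ∈ words n (K.image (d * ·)) ↔ v ∈ words e K) := by
    intro w v h
    have hper := isPeriodicPt_shift_iff.1 (isPeriodicPt_cyc v)
    rw [mem_words_iff_count, mem_words_iff_count]
    refine forall_congr' fun c => ?_
    rw [hcount, h, count_of_periodic (fun t => by rw [hper t]) hn]
    exact Nat.mul_right_inj hd.ne'
  have hn_per : ∀ v : Fin e → ℕ, Function.IsPeriodicPt shift n (cyc v) := fun v => by
    rw [← hn]
    exact (isPeriodicPt_cyc v).mul_const d
  refine card_nbij' (fun w t => cyc w t) (fun v t => cyc v t) ?_ ?_ ?_ ?_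
  · intro w hw
    obtain ⟨h1, h2⟩ := mem_filter.1 hw
    have h3 := cyc_eq_of_isPeriodicPt (e := e) (f := cyc w)
      (h2 ▸ Function.isPeriodicPt_minimalPeriod _ _)
    exact mem_filter.2 ⟨(hmem _ _ h3.symm).1 h1, by rw [h3, h2]⟩
  · intro v hv
    obtain ⟨h1, h2⟩ := mem_filter.1 hv
    have h3 := cyc_eq_of_isPeriodicPt (hn_per v)
    exact mem_filter.2 ⟨(hmem _ _ h3).2 h1, by rw [h3, h2]⟩
  · intro w hw
    obtain ⟨h1, h2⟩ := mem_filter.1 hw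
    have h3 := cyc_eq_of_isPeriodicPt (e := e) (f := cyc w)
      (h2 ▸ Function.isPeriodicPt_minimalPeriod _ _)
    funext t
    simp only [h3, cyc_coe]
  · intro v hv
    funext t
    simp only [cyc_eq_of_isPeriodicPt (hn_per v), cyc_coe]

/-- The set of all `j` such that `d * j` is an element of `I`. -/
def divSet (d : ℕ) (I : Finset ℕ) : Finset ℕ := (I.filter (d ∣ ·)).image (· / d)

theorem mem_divSet {d : ℕ} (hd : 0 < d) {I : Finset ℕ} {j : ℕ} :
    j ∈ divSet d I ↔ d * j ∈ I := by
  simp only [divSet, mem_image, mem_filter]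
  constructor
  · rintro ⟨i, ⟨hi, k, rfl⟩, rfl⟩
    rwa [Nat.mul_div_cancel_left _ hd]
  · intro h
    exact ⟨d * j, ⟨h, dvd_mul_right _ _⟩, Nat.mul_div_cancel_left _ hd⟩

theorem sum_powerset_words_minimalPeriod {n e d : ℕ} [NeZero n] [NeZero e] (hn : e * d = n)
    {I : Finset ℕ} (hI : I ⊆ Finset.Icc 1 (n - 1)) :
    ∑ K ∈ I.powerset, (-1 : ℤ) ^ (#I + #K) *
        (#{w ∈ words n K | Function.minimalPeriod shift (cyc w) = e} : ℤ) =
      ∑ K ∈ (divSet d I).powerset, (-1 : ℤ) ^ (#I + #K) * (#(primWords e K) : ℤ) := by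
  have hd : 0 < d := Nat.pos_of_ne_zero fun h => NeZero.ne n (by rw [← hn, h, mul_zero])
  have hinj : Function.Injective (d * · : ℕ → ℕ) := mul_right_injective₀ hd.ne'
  have h1 : ∀ K ∈ (divSet d I).powerset,
      (-1 : ℤ) ^ (#I + #K) * (#(primWords e K) : ℤ) =
      (-1 : ℤ) ^ (#I + #(K.image (d * ·))) *
        (#{w ∈ words n (K.image (d * ·)) | Function.minimalPeriod shift (cyc w) = e} : ℤ) := by
    intro K _
    rw [card_image_of_injective _ hinj, card_words_minimalPeriod hn]
  rw [sum_congr rfl h1, ← sum_image (s := (divSet d I).powerset) (g := image (d * ·))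
    (f := fun K => (-1 : ℤ) ^ (#I + #K) *
      (#{w ∈ words n K | Function.minimalPeriod shift (cyc w) = e} : ℤ))
    (fun _ _ _ _ h => image_injective hinj h)]
  symm
  refine sum_subset ?_ ?_
  · intro K hK
    obtain ⟨K', hK', rfl⟩ := mem_image.1 hK
    refine mem_powerset.2 fun k hk => ?_
    obtain ⟨j, hj, rfl⟩ := mem_image.1 hk
    exact (mem_divSet hd).1 (mem_powerset.1 hK' hj)
  -- A `K` with an element not divisible by `d` admits no word of period `e`.
  · intro K hK hK'
    rw [mem_powerset] at hK
    have : #{w ∈ words n K | Function.minimalPeriod shift (cyc w) = e} = 0 := by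
      rw [card_eq_zero, filter_eq_empty_iff]
      intro w hw hper
      have hdvd : ∀ k ∈ K, d ∣ k := fun k hk => dvd_of_mem_words hn (hK.trans hI) hw
        (hper ▸ Function.isPeriodicPt_minimalPeriod _ _) hk
      refine hK' (mem_image.2 ⟨K.image (· / d), mem_powerset.2 fun j hj => ?_, ?_⟩)
      · obtain ⟨k, hk, rfl⟩ := mem_image.1 hj
        rw [mem_divSet hd, Nat.mul_div_cancel' (hdvd k hk)]
        exact hK hk
      · rw [image_image]
        conv_rhs => rw [← image_id (s := K)]
        exact image_congr fun k hk => Nat.mul_div_cancel' (hdvd k hk)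
    rw [this]; simp

theorem sum_powerset_primWords (n : ℕ) [NeZero n] (I : Finset ℕ) :
    ∑ K ∈ I.powerset, (-1 : ℤ) ^ (#I + #K) * (#(primWords n K) : ℤ) = n * betaCyc n I := by
  have h := sum_powerset_neg_one_card_subset
    {p : Equiv.Perm (Fin n) × Fin n | IsFullCycle p.1} (fun p => descentSet p.1) I
  simp only [filter_filter, card_primWords] at h
  rw [h]
  have : ({p : Equiv.Perm (Fin n) × Fin n | IsFullCycle p.1 ∧ descentSet p.1 = I} : Finset _) =
      ({π : Equiv.Perm (Fin n) | IsFullCycle π ∧ descentSet π = I} : Finset _) ×ˢ univ := by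
    ext; simp
  rw [this, card_product, card_univ, Fintype.card_fin, betaCyc]
  push_cast
  ring

/-- Words are sorted by minimal period `e`, and the alternating sum for each `e` is that of
primitive words of length `e` over subsets of `divSet (n / e) I`. -/
theorem beta_eq_sum_divisors {n : ℕ} (hn : n ≠ 0) {I : Finset ℕ}
    (hI : I ⊆ Finset.Icc 1 (n - 1)) :
    (beta n I : ℤ) = ∑ e ∈ n.divisors,
      (-1) ^ (#I + #(divSet (n / e) I)) * ((e : ℤ) * betaCyc e (divSet (n / e) I)) := by
  have : NeZero n := ⟨hn⟩
  have h := sum_powerset_neg_one_card_subset (univ : Finset (Equiv.Perm (Fin n))) descentSet I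
  rw [beta, ← h]
  have h1 : ∀ K, (#{π : Equiv.Perm (Fin n) | descentSet π ⊆ K} : ℤ) = ∑ e ∈ n.divisors,
      (#{w ∈ words n K | Function.minimalPeriod shift (cyc w) = e} : ℤ) := by
    intro K
    rw [card_words, card_eq_sum_card_fiberwise (t := n.divisors)
      (f := fun w => Function.minimalPeriod shift (cyc w))]
    · push_cast; rfl
    · intro w _
      exact Nat.mem_divisors.2 ⟨(isPeriodicPt_cyc w).minimalPeriod_dvd, hn⟩
  simp only [h1, mul_sum]
  rw [sum_comm]
  refine sum_congr rfl fun e he => ?_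
  have hen := Nat.dvd_of_mem_divisors he
  have : NeZero e := ⟨(Nat.pos_of_mem_divisors he).ne'⟩
  rw [sum_powerset_words_minimalPeriod (Nat.mul_div_cancel' hen) hI, ← sum_powerset_primWords,
    mul_sum]
  refine sum_congr rfl fun K _ => ?_
  rw [← mul_assoc, ← pow_add]
  congr 1
  rw [show #I + #(divSet (n / e) I) + (#(divSet (n / e) I) + #K) =
    #I + #K + 2 * #(divSet (n / e) I) by ring, pow_add _ (#I + #K), pow_mul]
  simp

theorem betaCyc_le_factorial (n : ℕ) (I : Finset ℕ) : betaCyc n I ≤ n.factorial := by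
  refine (card_filter_le _ _).trans ?_
  rw [card_univ, Fintype.card_perm, Fintype.card_fin]

/-- The number of `n`-cycles with descent set `I` differs from `β_n(I) / n` by at most the
contribution of the proper divisors of `n`. -/
theorem abs_mul_betaCyc_sub_beta_le {n : ℕ} (hn : n ≠ 0) {I : Finset ℕ}
    (hI : I ⊆ Finset.Icc 1 (n - 1)) :
    |(n : ℤ) * betaCyc n I - beta n I| ≤ n * (n * (n / 2).factorial) := by
  have hdiv : divSet (n / n) I = I := by
    ext j
    rw [mem_divSet (by simp [Nat.pos_of_ne_zero hn]), Nat.div_self (Nat.pos_of_ne_zero hn),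
      one_mul]
  rw [beta_eq_sum_divisors hn hI, ← Nat.insert_self_properDivisors hn,
    sum_insert Nat.self_notMem_properDivisors, hdiv, ← two_mul, pow_mul]
  simp only [neg_one_sq, one_pow, one_mul, sub_add_cancel_left, abs_neg]
  refine (abs_sum_le_sum_abs _ _).trans ?_
  have hcard : #n.properDivisors ≤ n := by
    have : n.properDivisors ⊆ Finset.Ico 1 n := filter_subset _ _
    simpa using (card_le_card this).trans (by simp)
  refine (sum_le_card_nsmul _ _ ((n : ℤ) * (n / 2).factorial) ?_).trans ?_
  · intro e he
    obtain ⟨hdvd, hlt⟩ := Nat.mem_properDivisors.1 he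
    have he2 : e ≤ n / 2 := by
      obtain ⟨k, rfl⟩ := hdvd
      have : 2 ≤ k := by
        by_contra hk
        interval_cases k <;> simp at hlt
      rw [Nat.le_div_iff_mul_le two_pos]
      exact Nat.mul_le_mul_left e this
    have h1 : betaCyc e (divSet (n / e) I) ≤ (n / 2).factorial :=
      (betaCyc_le_factorial _ _).trans (Nat.factorial_le he2)
    rw [abs_mul, abs_pow, abs_neg, abs_one, one_pow, one_mul]
    exact_mod_cast Nat.mul_le_mul hlt.le h1
  · rw [nsmul_eq_mul]
    exact_mod_cast Nat.mul_le_mul_right _ hcard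

/-! ### Lower bound for `beta` by inserting one entry at a time -/

section cycleIcc

variable {n : ℕ} {j m b : Fin n}

/-- Precomposing a sequence with the inverse of `Fin.cycleIcc j m` moves entry `m` to position `j`
and pushes the entries from `j` to `m - 1` one place right. -/
theorem cycleIcc_symm_of_lt (h : b < j) : (Fin.cycleIcc j m).symm b = b := by
  rw [Equiv.symm_apply_eq, Fin.cycleIcc_of_lt h]

theorem cycleIcc_symm_left (h : j ≤ m) : (Fin.cycleIcc j m).symm j = m := by
  have : NeZero n := j.neZero
  rw [Equiv.symm_apply_eq, Fin.cycleIcc_of_last h]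

theorem cycleIcc_symm_succ {a : Fin n} (hab : (a : ℕ) + 1 = b) (hja : j ≤ a) (ham : a < m) :
    (Fin.cycleIcc j m).symm b = a := by
  have : NeZero n := j.neZero
  rw [Equiv.symm_apply_eq, Fin.cycleIcc_of_ge_of_lt hja ham]
  apply Fin.ext
  rw [Fin.val_add_one_of_lt' (by omega), hab]

end cycleIcc

/-- Moving the entry at position `m` into the increasing run that starts at `lo` and ends just
before `m` makes the run one longer and keeps the earlier ascents and descents. -/
theorem exists_insert_into_run {n : ℕ} {α : Type*} [LinearOrder α] {x : Fin n → α}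
    (hx : Function.Injective x) {p : ℕ → Prop} {lo m : Fin n} (hlm : lo < m)
    (hm : ¬ p m) (hrun : ∀ i : ℕ, lo < i → i < m → ¬ p i) (hlo : (lo : ℕ) = 0 ∨ p lo)
    (hpat : ∀ a b : Fin n, (a : ℕ) + 1 = b → b < m → (x b < x a ↔ p b)) :
    ∃ j ∈ Finset.Icc lo m, ∀ a b : Fin n, (a : ℕ) + 1 = b → b ≤ m →
      (x ((Fin.cycleIcc j m).symm b) < x ((Fin.cycleIcc j m).symm a) ↔ p b) := by
  have hrun' : ∀ i : ℕ, lo < i → i ≤ m → ¬ p i := fun i h1 h2 => by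
    rcases Nat.lt_or_eq_of_le h2 with h | rfl
    · exact hrun i h1 h
    · exact hm
  have hne : ({j ∈ Finset.Icc lo m | x m ≤ x j} : Finset (Fin n)).Nonempty :=
    ⟨m, by simp [hlm.le]⟩
  -- The new entry goes in front of the first run entry that is not smaller; `j = m` leaves it in
  -- place.
  obtain ⟨j, hj, hjmin⟩ := exists_min_image _ id hne
  simp only [mem_filter, id] at hj hjmin
  obtain ⟨hjI, hmj⟩ := hj
  obtain ⟨hlj, hjm⟩ := Finset.mem_Icc.1 hjI
  refine ⟨j, hjI, fun a b hab hbm => ?_⟩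
  rcases lt_trichotomy b j with hbj | rfl | hjb
  · have haj : a < j := by omega
    rw [cycleIcc_symm_of_lt hbj, cycleIcc_symm_of_lt haj]
    exact hpat a b hab (by omega)
  · rw [cycleIcc_symm_left hjm, cycleIcc_symm_of_lt (by omega : a < b)]
    rcases hlj.eq_or_lt with rfl | hlj
    -- Inserted at the start of the run, the entry is at most the old first one, so the descent into
    -- `lo` survives.
    · have hp : p lo := hlo.resolve_left (by omega)
      exact iff_of_true (hmj.trans_lt ((hpat a lo hab hlm).2 hp)) hp
    · refine iff_of_false (fun h => ?_) (hrun' b (by omega) (by omega))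
      have := hjmin a ⟨Finset.mem_Icc.2 ⟨by omega, by omega⟩, h.le⟩
      omega
  · rw [cycleIcc_symm_succ hab (by omega) (by omega)]
    have hb : ¬ p b := hrun' b (by omega) (by omega)
    rcases (show j ≤ a by omega).eq_or_lt with rfl | hja
    · rw [cycleIcc_symm_left hjm]
      exact iff_of_false hmj.not_gt hb
    · have ha0 : (a : ℕ) - 1 < n := by omega
      rw [cycleIcc_symm_succ (a := ⟨a - 1, ha0⟩) (by simp; omega) (by simp [Fin.le_def]; omega)
        (by simp [Fin.lt_def]; omega)]
      refine iff_of_false (fun h => ?_) hb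
      have h1 := hpat ⟨a - 1, ha0⟩ a (by simp; omega) (by omega)
      have h2 : ¬ p a := hrun' a (by omega) (by omega)
      have h3 : a ≠ ⟨a - 1, ha0⟩ := fun h => by
        have := congrArg Fin.val h
        simp at this
        omega
      exact h.asymm (lt_of_le_of_ne (not_lt.1 (mt h1.1 h2)) (hx.ne h3.symm))

/-- The permutations of `Fin n` whose first `m` entries have descents exactly at the places
prescribed by `I`. -/
def prefixPerms (n : ℕ) (I : Finset ℕ) (m : ℕ) : Finset (Equiv.Perm (Fin n)) :=
  {π | ∀ a b : Fin n, (a : ℕ) + 1 = b → (b : ℕ) < m → (π b < π a ↔ (b : ℕ) ∈ I)}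

/-- Moving entry `m` into the last run extends the prescribed pattern by one place. Given `j` the
move is reversible, and `j` has `m - lo + 1` possible values. -/
theorem card_prefixPerms_le {n : ℕ} {I : Finset ℕ} {lo m : ℕ} (hlm : lo < m) (hmn : m < n)
    (hrun : ∀ i, lo < i → i < m → (i ∈ I ↔ m ∈ I)) (hlo : lo = 0 ∨ (lo ∈ I ↔ m ∉ I)) :
    #(prefixPerms n I m) ≤ (m - lo + 1) * #(prefixPerms n I (m + 1)) := by
  obtain ⟨lo, rfl⟩ : ∃ l : Fin n, (l : ℕ) = lo := ⟨⟨lo, by omega⟩, rfl⟩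
  obtain ⟨m, rfl⟩ : ∃ l : Fin n, (l : ℕ) = m := ⟨⟨m, by omega⟩, rfl⟩
  have hins : ∀ π ∈ prefixPerms n I m, ∃ j ∈ Finset.Icc lo m,
      π * (Fin.cycleIcc j m)⁻¹ ∈ prefixPerms n I (m + 1) := by
    intro π hπ
    simp only [prefixPerms, mem_filter, mem_univ, true_and, Equiv.Perm.mul_apply,
      Equiv.Perm.inv_def] at hπ ⊢
    by_cases hm : (m : ℕ) ∈ I
    -- A decreasing run is an increasing one for the dual order.
    · obtain ⟨j, hj, h⟩ := exists_insert_into_run (x := OrderDual.toDual ∘ π)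
        (p := fun i => i ∉ I) (OrderDual.toDual.injective.comp π.injective)
        (Fin.lt_def.2 hlm) (not_not.2 hm) (fun i h1 h2 => not_not.2 ((hrun i h1 h2).2 hm))
        (hlo.imp_right fun h h' => h.1 h' hm) fun a b hab hb => by
          rw [← hπ a b hab hb, not_lt]
          have : π a ≠ π b := fun h => by have := π.injective h; omega
          exact ⟨fun h => le_of_lt h, fun h => lt_of_le_of_ne h this.symm⟩
      refine ⟨j, hj, fun a b hab hb => ?_⟩
      have h1 := h a b hab (by omega)
      rw [← not_iff_not, ← h1, not_lt]
      have : (Fin.cycleIcc j m).symm a ≠ (Fin.cycleIcc j m).symm b := fun h => by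
        have := (Fin.cycleIcc j m).symm.injective h; omega
      exact ⟨fun h => lt_of_le_of_ne h (π.injective.ne this.symm), fun h => le_of_lt h⟩
    · obtain ⟨j, hj, h⟩ := exists_insert_into_run (x := π) (p := fun i => i ∈ I) π.injective
        (Fin.lt_def.2 hlm) hm (fun i h1 h2 => fun h => hm ((hrun i h1 h2).1 h))
        (hlo.imp_right fun h => h.2 hm) hπ
      exact ⟨j, hj, fun a b hab hb => h a b hab (by omega)⟩
  have hsub : prefixPerms n I m ⊆ (Finset.Icc lo m).biUnion fun j =>
      (prefixPerms n I (m + 1)).image (· * Fin.cycleIcc j m) := by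
    intro π hπ
    obtain ⟨j, hj, h⟩ := hins π hπ
    exact mem_biUnion.2 ⟨j, hj, mem_image.2 ⟨_, h, by simp⟩⟩
  refine (card_le_card hsub).trans ((card_biUnion_le_card_mul _ _ _ fun j _ => card_image_le).trans
    (Nat.mul_le_mul_right _ ?_))
  rw [Fin.card_Icc]
  omega

theorem mem_altSet {n : ℕ} {I : Finset ℕ} {i : ℕ} :
    i ∈ altSet n I ↔ 1 ≤ i ∧ i + 2 ≤ n ∧ ¬ (i ∈ I ↔ i + 1 ∈ I) := by
  have h : (I ∩ {i, i + 1}).card = 1 ↔ ¬ (i ∈ I ↔ i + 1 ∈ I) := by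
    by_cases h1 : i ∈ I <;> by_cases h2 : i + 1 ∈ I <;>
      simp [inter_insert_of_mem, inter_insert_of_notMem, h1, h2]
  simp only [altSet, mem_filter, Finset.mem_Icc, h]
  constructor
  · rintro ⟨⟨h1, h2⟩, h3⟩
    exact ⟨h1, by omega, h3⟩
  · rintro ⟨h1, h2, h3⟩
    exact ⟨⟨h1, by omega⟩, h3⟩

theorem altSet_succ {m : ℕ} {I : Finset ℕ} (hm : 2 ≤ m) (h : ¬ (m - 1 ∈ I ↔ m ∈ I)) :
    altSet (m + 1) I = insert (m - 1) (altSet m I) := by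
  ext i
  rw [mem_insert, mem_altSet, mem_altSet]
  constructor
  · rintro ⟨h1, h2, h3⟩
    by_cases hi : i = m - 1
    · exact Or.inl hi
    · exact Or.inr ⟨h1, by omega, h3⟩
  · rintro (rfl | ⟨h1, h2, h3⟩)
    · exact ⟨by omega, by omega, by rwa [Nat.sub_add_cancel (by omega)]⟩
    · exact ⟨h1, by omega, h3⟩

theorem altSet_succ_of_iff {m : ℕ} {I : Finset ℕ} (h : 2 ≤ m → (m - 1 ∈ I ↔ m ∈ I)) :
    altSet (m + 1) I = altSet m I := by
  ext i
  rw [mem_altSet, mem_altSet]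
  constructor
  · rintro ⟨h1, h2, h3⟩
    refine ⟨h1, ?_, h3⟩
    by_contra hi
    obtain rfl : i = m - 1 := by omega
    rw [Nat.sub_add_cancel (by omega)] at h3
    exact h3 (h (by omega))
  · rintro ⟨h1, h2, h3⟩
    exact ⟨h1, by omega, h3⟩

theorem alt_le (m : ℕ) (I : Finset ℕ) : alt m I ≤ m - 2 := by
  have : altSet m I ⊆ Finset.Icc 1 (m - 2) := filter_subset _ _
  simpa [alt] using card_le_card this

/-- Each new position costs a factor `2` at an alternation and at most `m - alt m I + 1` elsewhere;
these factors multiply to the stated weight. -/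
theorem factorial_le_card_prefixPerms (n : ℕ) (I : Finset ℕ) {m : ℕ} (hm : 1 ≤ m) (hmn : m ≤ n) :
    n.factorial ≤ #(prefixPerms n I m) * (2 ^ alt m I * (m - alt m I).factorial) := by
  induction m, hm using Nat.le_induction with
  | base =>
    have h1 : alt 1 I = 0 := by have := alt_le 1 I; omega
    have h2 : prefixPerms n I 1 = univ := by
      ext π
      simp only [prefixPerms, mem_filter, mem_univ, true_and, iff_true]
      intro a b h h'
      omega
    simp [h1, h2, Fintype.card_perm]
  | succ m hm ih =>
    refine (ih (by omega)).trans ?_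
    have ha := alt_le m I
    by_cases h : 2 ≤ m → (m - 1 ∈ I ↔ m ∈ I)
    -- The last alternation starts the current run; without alternations the supremum is `0`, the
    -- first position. All alternations lie in `1, …, lo`, so `alt m I ≤ lo`.
    · set lo := (altSet m I).sup id with hlo
      have hle : ∀ i ∈ altSet m I, i ≤ lo := fun i hi => le_sup (f := id) hi
      have hcard : alt m I ≤ lo := by
        have : altSet m I ⊆ Finset.Icc 1 lo := fun i hi =>
          Finset.mem_Icc.2 ⟨(mem_altSet.1 hi).1, hle i hi⟩
        simpa [alt] using card_le_card this
      have hlo' : lo = 0 ∨ lo ∈ altSet m I := by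
        rcases (altSet m I).eq_empty_or_nonempty with h0 | h0
        · left; simp [hlo, h0]
        · right
          obtain ⟨i, hi, h⟩ := exists_mem_eq_sup _ h0 id
          rw [hlo, h]; exact hi
      have hlt : lo < m := by
        rcases hlo' with h0 | h0
        · omega
        · have := (mem_altSet.1 h0).2.1
          omega
      have hrun : ∀ k i, lo < i → i + k = m → (i ∈ I ↔ m ∈ I) := by
        intro k
        induction k with
        | zero => rintro i _ rfl; rfl
        | succ k ihk =>
          intro i hi hik
          rw [← ihk (i + 1) (by omega) (by omega)]
          by_contra hne
          rcases Nat.eq_zero_or_pos k with rfl | hk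
          · obtain rfl : i = m - 1 := by omega
            rw [Nat.sub_add_cancel (by omega)] at hne
            exact hne (h (by omega))
          · have := hle i (mem_altSet.2 ⟨by omega, by omega, hne⟩)
            omega
      have hstep := card_prefixPerms_le (n := n) (I := I) hlt (by omega)
        (fun i h1 h2 => hrun (m - i) i h1 (by omega)) <| hlo'.imp_right fun h0 => by
          obtain ⟨_, h2, h3⟩ := mem_altSet.1 h0
          rw [hrun (m - (lo + 1)) (lo + 1) (by omega) (by omega)] at h3
          tauto
      have hsucc : alt (m + 1) I = alt m I := by rw [alt, altSet_succ_of_iff h, alt]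
      rw [hsucc, show m + 1 - alt m I = m - alt m I + 1 by omega, Nat.factorial_succ]
      calc _ ≤ (m - lo + 1) * #(prefixPerms n I (m + 1)) *
            (2 ^ alt m I * (m - alt m I).factorial) := Nat.mul_le_mul_right _ hstep
        _ ≤ (m - alt m I + 1) * #(prefixPerms n I (m + 1)) *
            (2 ^ alt m I * (m - alt m I).factorial) := by gcongr
        _ = _ := by ring
    · push Not at h
      obtain ⟨h2, h⟩ := h
      have h' : ¬ (m - 1 ∈ I ↔ m ∈ I) := by tauto
      -- At an alternation the run is the single entry `m - 1`, leaving two places to insert.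
      have hstep := card_prefixPerms_le (n := n) (I := I) (lo := m - 1) (m := m) (by omega)
        (by omega) (fun i _ _ => by omega) (Or.inr (by tauto))
      have hsucc : alt (m + 1) I = alt m I + 1 := by
        rw [alt, altSet_succ h2 h', card_insert_of_notMem, alt]
        intro h0
        have := (mem_altSet.1 h0).2.1
        omega
      rw [hsucc, show m + 1 - (alt m I + 1) = m - alt m I by omega]
      rw [show m - (m - 1) + 1 = 2 by omega] at hstep
      calc _ ≤ 2 * #(prefixPerms n I (m + 1)) *
            (2 ^ alt m I * (m - alt m I).factorial) := Nat.mul_le_mul_right _ hstep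
        _ = _ := by ring

theorem prefixPerms_self_subset {n : ℕ} {I : Finset ℕ} (hI : I ⊆ Finset.Icc 1 (n - 1)) :
    prefixPerms n I n ⊆ ({π | descentSet π = I} : Finset (Equiv.Perm (Fin n))) := by
  intro π hπ
  simp only [prefixPerms, mem_filter, mem_univ, true_and] at hπ ⊢
  ext i
  rw [mem_descentSet]
  constructor
  · rintro ⟨h, h', hlt⟩
    exact (hπ ⟨i - 1, by omega⟩ ⟨i, by omega⟩ (by simp; omega) (by simp; omega)).1 hlt
  · intro hi
    have := Finset.mem_Icc.1 (hI hi)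
    exact ⟨by omega, this.1,
      (hπ ⟨i - 1, by omega⟩ ⟨i, by omega⟩ (by simp; omega) (by simp; omega)).2 hi⟩

/-- A lower bound for `β_n(I)` in terms of the alternation number. -/
theorem factorial_le_beta_mul {n : ℕ} (hn : 1 ≤ n) {I : Finset ℕ}
    (hI : I ⊆ Finset.Icc 1 (n - 1)) :
    n.factorial ≤ beta n I * (2 ^ alt n I * (n - alt n I).factorial) :=
  (factorial_le_card_prefixPerms n I hn le_rfl).trans
    (Nat.mul_le_mul_right _ (card_le_card (prefixPerms_self_subset hI)))

end DescentCycles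

/-! ### Asymptotic estimates -/

namespace DescentCycles

/-- Raising `b` by one multiplies the weight by `2 / (n - b)`, which is at most `1` in this range.
-/
theorem two_pow_mul_factorial_le {n a b : ℕ} (hn : 2 ≤ n) (hab : a ≤ b) (hb : b ≤ n - 2) :
    2 ^ b * (n - b).factorial ≤ 2 ^ a * (n - a).factorial := by
  have h := Nat.factorial_mul_pow_le_factorial (m := n - b) (n := b - a)
  rw [show n - b + (b - a) = n - a by omega] at h
  calc 2 ^ b * (n - b).factorial = 2 ^ a * ((n - b).factorial * 2 ^ (b - a)) := by
        rw [← Nat.add_sub_of_le hab, pow_add, Nat.add_sub_cancel_left]; ring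
    _ ≤ 2 ^ a * ((n - b).factorial * (n - b + 1) ^ (b - a)) := by gcongr; omega
    _ ≤ _ := Nat.mul_le_mul_left _ h

theorem two_pow_half_mul_factorial_le_beta {n t : ℕ} (hn : 2 ≤ n) {I : Finset ℕ}
    (hI : I ⊆ Finset.Icc 1 (n - 1)) (ht : n / 2 ≤ alt n I + t) :
    2 ^ (n / 2) * (n / 2).factorial ≤ (n + 1) * (2 * n) ^ t * beta n I := by
  set m := n / 2 with hm
  -- By monotonicity of the weight, `alt n I` may be replaced by this smaller value; the subtraction
  -- is truncated, so `a = 0` when `t ≥ n / 2`.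
  obtain ⟨a, ha⟩ : ∃ a, a = m - t := ⟨_, rfl⟩
  have h1 : n.factorial ≤ beta n I * (2 ^ a * (n - a).factorial) :=
    (factorial_le_beta_mul (by omega) hI).trans
      (Nat.mul_le_mul_left _ (two_pow_mul_factorial_le hn (by omega) (alt_le n I)))
  rw [← Nat.choose_mul_factorial_mul_factorial (show a ≤ n by omega), ← mul_assoc] at h1
  have h2 : n.choose a * a.factorial ≤ beta n I * 2 ^ a :=
    Nat.le_of_mul_le_mul_right h1 (Nat.factorial_pos _)
  have h3 : m.factorial ≤ a.factorial * n ^ t := by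
    rw [show m = a + (m - a) by omega, ← Nat.factorial_mul_ascFactorial]
    gcongr
    refine (Nat.ascFactorial_le_pow_add a (m - a)).trans ?_
    calc (a + (m - a)) ^ (m - a) ≤ n ^ (m - a) := Nat.pow_le_pow_left (by omega) _
      _ ≤ n ^ t := Nat.pow_le_pow_right (by omega) (by omega)
  -- As `2 * a ≤ n`, the central binomial coefficient of `2 * a` bounds `n.choose a` from below.
  have h4 : 4 ^ a ≤ (n + 1) * n.choose a := by
    refine (Nat.four_pow_le_two_mul_add_one_mul_central_binom a).trans ?_
    exact Nat.mul_le_mul (by omega) (Nat.choose_le_choose a (by omega))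
  have h5 : 2 ^ a * m.factorial ≤ (n + 1) * n ^ t * beta n I := by
    refine Nat.le_of_mul_le_mul_left (c := 2 ^ a) ?_ (by positivity)
    calc 2 ^ a * (2 ^ a * m.factorial) = 4 ^ a * m.factorial := by
          rw [← mul_assoc, ← mul_pow]; norm_num
      _ ≤ (n + 1) * n.choose a * (a.factorial * n ^ t) := Nat.mul_le_mul h4 h3
      _ = (n + 1) * n ^ t * (n.choose a * a.factorial) := by ring
      _ ≤ (n + 1) * n ^ t * (beta n I * 2 ^ a) := Nat.mul_le_mul_left _ h2
      _ = _ := by ring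
  calc 2 ^ m * m.factorial ≤ 2 ^ (a + t) * m.factorial := by
        gcongr
        · norm_num
        · omega
    _ = 2 ^ t * (2 ^ a * m.factorial) := by ring
    _ ≤ 2 ^ t * ((n + 1) * n ^ t * beta n I) := Nat.mul_le_mul_left _ h5
    _ = _ := by rw [mul_pow]; ring

theorem abs_ratio_sub_one_le {n t : ℕ} (hn : 2 ≤ n) {I : Finset ℕ}
    (hI : I ⊆ Finset.Icc 1 (n - 1)) (ht : n / 2 ≤ alt n I + t) :
    |(n : ℝ) * (betaCyc n I : ℝ) / (beta n I : ℝ) - 1| ≤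
      (2 * n : ℝ) ^ (t + 3) / 2 ^ (n / 2) := by
  have h := two_pow_half_mul_factorial_le_beta hn hI ht
  have hpos : 0 < beta n I := by
    have : 0 < 2 ^ (n / 2) * (n / 2).factorial := by positivity
    exact Nat.pos_of_mul_pos_left (this.trans_le h)
  have hposR : (0 : ℝ) < beta n I := by exact_mod_cast hpos
  have h1 : |(n : ℝ) * betaCyc n I - beta n I| ≤ n * (n * (n / 2).factorial) := by
    exact_mod_cast abs_mul_betaCyc_sub_beta_le (by omega) hI
  have h2 : (2 : ℝ) ^ (n / 2) * (n / 2).factorial ≤ (n + 1) * (2 * n) ^ t * beta n I := by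
    exact_mod_cast h
  have hn' : (2 : ℝ) ≤ n := by exact_mod_cast hn
  rw [div_sub_one hposR.ne', abs_div, abs_of_pos hposR, div_le_div_iff₀ hposR (by positivity)]
  calc |(n : ℝ) * betaCyc n I - beta n I| * 2 ^ (n / 2)
      ≤ n * (n * (n / 2).factorial) * 2 ^ (n / 2) := by gcongr
    _ = n * n * (2 ^ (n / 2) * (n / 2).factorial) := by ring
    _ ≤ n * n * ((n + 1) * (2 * n) ^ t * beta n I) := by gcongr
    _ = n * n * (n + 1) * ((2 * n) ^ t * beta n I) := by ring
    -- The polynomial factor `n * n * (n + 1)` accounts for the `3` in the exponent.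
    _ ≤ (2 * n) * (2 * n) * (2 * n) * ((2 * n) ^ t * beta n I) := by
        gcongr <;> linarith
    _ = _ := by ring

/-- After factoring out `x`, the bracket tends to `-(log 2) / 2`, because `log (2x)` is negligible
against `x ^ ε` and against `x`. -/
theorem tendsto_exponent_atBot {ε : ℝ} (hε : 0 < ε) :
    Tendsto (fun x : ℝ => (x ^ (1 - ε) + 4) * Real.log (2 * x) - (x / 2 - 1) * Real.log 2)
      atTop atBot := by
  have h1 : ∀ r : ℝ, 0 < r → Tendsto (fun x : ℝ => Real.log (2 * x) * x ^ (-r)) atTop (𝓝 0) := by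
    intro r hr
    have h2 := (isLittleO_log_rpow_atTop hr).tendsto_div_nhds_zero
    have h3 := (tendsto_rpow_neg_atTop hr).const_mul (Real.log 2)
    have h4 := h3.add h2
    rw [mul_zero, zero_add] at h4
    refine h4.congr' ?_
    filter_upwards [eventually_gt_atTop 0] with x hx
    rw [Real.log_mul two_ne_zero hx.ne', Real.rpow_neg hx.le]
    ring
  have h2 := ((h1 ε hε).add ((h1 1 one_pos).const_mul 4)).add
    ((tendsto_rpow_neg_atTop one_pos).const_mul (Real.log 2))
  have h3 := h2.sub_const (Real.log 2 / 2)
  have hneg : (0 + 4 * 0 + Real.log 2 * 0 - Real.log 2 / 2 : ℝ) < 0 := by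
    have := Real.log_pos one_lt_two
    linarith
  refine (tendsto_id.atTop_mul_neg hneg h3).congr' ?_
  filter_upwards [eventually_gt_atTop 0] with x hx
  rw [sub_eq_add_neg 1 ε, Real.rpow_add hx, Real.rpow_one, Real.rpow_neg_one]
  simp only [id]
  field_simp
  ring

theorem tendsto_pow_ceil_div_two_pow {ε : ℝ} (hε : 0 < ε) :
    Tendsto (fun n : ℕ => (2 * n : ℝ) ^ (⌈(n : ℝ) ^ (1 - ε)⌉₊ + 3) / 2 ^ (n / 2))
      atTop (𝓝 0) := by
  refine squeeze_zero' (Eventually.of_forall fun n => by positivity) ?_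
    (Real.tendsto_exp_atBot.comp
      ((tendsto_exponent_atBot hε).comp tendsto_natCast_atTop_atTop))
  filter_upwards [eventually_ge_atTop 1] with n hn
  have hn' : (1 : ℝ) ≤ n := by exact_mod_cast hn
  have hlog : 0 ≤ Real.log (2 * n) := Real.log_nonneg (by linarith)
  -- Rounding up turns `3` into `4`; rounding `n / 2` down costs the `1` in `h2`.
  have h1 : ((⌈(n : ℝ) ^ (1 - ε)⌉₊ + 3 : ℕ) : ℝ) ≤ (n : ℝ) ^ (1 - ε) + 4 := by
    have := (Nat.ceil_lt_add_one (a := (n : ℝ) ^ (1 - ε)) (by positivity)).le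
    push_cast
    linarith
  have h2 : (n : ℝ) / 2 - 1 ≤ ((n / 2 : ℕ) : ℝ) := by
    have : (n : ℝ) ≤ 2 * ((n / 2 : ℕ) : ℝ) + 1 := by
      exact_mod_cast (by omega : n ≤ 2 * (n / 2) + 1)
    linarith
  have h3 := Real.log_pos one_lt_two
  simp only [Function.comp]
  rw [← Real.exp_log (show (0 : ℝ) < (2 * n) ^ (⌈(n : ℝ) ^ (1 - ε)⌉₊ + 3) / 2 ^ (n / 2) by
    positivity), Real.exp_le_exp, Real.log_div (by positivity) (by positivity), Real.log_pow,
    Real.log_pow]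
  gcongr

theorem highAlt_finite (ε : ℝ) (n : ℕ) : (highAlt ε n).Finite :=
  (Finset.finite_toSet (Finset.Icc 1 (n - 1)).powerset).subset fun _ hI =>
    Finset.mem_coe.2 (Finset.mem_powerset.2 hI.1)

theorem highAlt_nonempty (ε : ℝ) {n : ℕ} (hn : 4 ≤ n) : (highAlt ε n).Nonempty := by
  -- This set alternates everywhere, so its alternation number is `n - 2`, at least `n / 2` once `n
  -- ≥ 4`.
  refine ⟨{i ∈ Finset.Icc 1 (n - 1) | Even i}, Finset.filter_subset _ _, ?_⟩
  have h : altSet n {i ∈ Finset.Icc 1 (n - 1) | Even i} = Finset.Icc 1 (n - 2) := by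
    ext i
    rw [mem_altSet]
    simp only [Finset.mem_filter, Finset.mem_Icc, Nat.even_add_one]
    constructor
    · rintro ⟨h1, h2, -⟩
      omega
    · rintro ⟨h1, h2⟩
      refine ⟨h1, by omega, ?_⟩
      have h3 : i ≤ n - 1 := by omega
      have h4 : i + 1 ≤ n - 1 := by omega
      simp only [h1, h3, h4, and_self, true_and, le_add_iff_nonneg_left, zero_le]
      tauto
  have h' : alt n {i ∈ Finset.Icc 1 (n - 1) | Even i} = n - 2 := by
    rw [alt, h, Nat.card_Icc]; omega
  rw [h', Nat.cast_sub (by omega)]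
  have hn' : (4 : ℝ) ≤ n := by exact_mod_cast hn
  have : (0 : ℝ) < (n : ℝ) ^ (1 - ε) := by positivity
  push_cast
  linarith

theorem half_le_alt_add_of_mem_highAlt {ε : ℝ} {n : ℕ} {I : Finset ℕ} (hI : I ∈ highAlt ε n) :
    n / 2 ≤ alt n I + ⌈(n : ℝ) ^ (1 - ε)⌉₊ := by
  have h1 := hI.2
  have h2 := Nat.le_ceil ((n : ℝ) ^ (1 - ε))
  have h3 : ((n / 2 : ℕ) : ℝ) ≤ (n : ℝ) / 2 := Nat.cast_div_le
  have : ((n / 2 : ℕ) : ℝ) ≤ ((alt n I + ⌈(n : ℝ) ^ (1 - ε)⌉₊ : ℕ) : ℝ) := by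
    push_cast
    linarith
  exact_mod_cast this

end DescentCycles

/-- For `n ≥ 4` the collection `𝓘_n` is nonempty for every `ε > 0`, so that the maximum `M n`
over it exists; and `M n → 0`. -/
theorem mainTheorem3 (ε : ℝ) (hε : 0 < ε) :
    ∃ M : ℕ → ℝ,
      (∀ n : ℕ, 4 ≤ n →
        IsGreatest
          ((fun I : Finset ℕ =>
            |(n : ℝ) * (DescentCycles.betaCyc n I : ℝ) / (DescentCycles.beta n I : ℝ) - 1|) ''
              DescentCycles.highAlt ε n)
          (M n)) ∧
      Tendsto M atTop (𝓝 0) := by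
  have hex : ∀ n : ℕ, 4 ≤ n → ∃ x, IsGreatest ((fun I : Finset ℕ =>
      |(n : ℝ) * (DescentCycles.betaCyc n I : ℝ) / (DescentCycles.beta n I : ℝ) - 1|) ''
        DescentCycles.highAlt ε n) x := fun n hn =>
    ((DescentCycles.highAlt_finite ε n).image _).isCompact.exists_isGreatest
      ((DescentCycles.highAlt_nonempty ε hn).image _)
  -- The value `0` for `n < 4` is arbitrary and does not affect the limit.
  refine ⟨fun n => if hn : 4 ≤ n then (hex n hn).choose else 0, fun n hn => ?_, ?_⟩
  · simp only [hn, dif_pos]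
    exact (hex n hn).choose_spec
  · refine squeeze_zero_norm' ?_ (DescentCycles.tendsto_pow_ceil_div_two_pow hε)
    filter_upwards [eventually_ge_atTop 4] with n hn
    simp only [hn, dif_pos]
    obtain ⟨I, hI, h⟩ := (hex n hn).choose_spec.1
    rw [← h, Real.norm_eq_abs, abs_abs]
    exact DescentCycles.abs_ratio_sub_one_le (by omega) hI.1
      (DescentCycles.half_le_alt_add_of_mem_highAlt hI)
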